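/- Let $K$ be a field complete for an ultrametric norm $|\cdot|$, with infinite residue field and with value group $|K^*|=\{|z| : z\in K^*\}\subset\mathbb{R}_{>0}$ not discrete. Let $\mathbb{P}^1_K=K\sqcup\{\infty\}$ be the projective line. A ball of $K$ is a set $\{z : |z-a|<r\}$ or $\{z : |z-a|\le r\}$ with $a\in K$, $r>0$; it is called open, resp. closed, if $r\in|K^*|$, and irrational if $r\notin|K^*|$ (the two sets then coincide). An open (resp. closed, irrational) ball of $\mathbb{P}^1_K$ is an open (resp. closed, irrational) ball of $K$ or the complement in $\mathbb{P}^1_K$ of a closed (resp. open, irrational) ball of $K$. An open affinoid is a finite (possibly empty) intersection of open balls of $\mathbb{P}^1_K$. Give $\mathbb{P}^1_K$ the uniform structure whose entourages are the sets containing $V(C)=\bigcup_{Y\in C}Y\times Y$ for some finite cover $C$ of $\mathbb{P}^1_K$ by open affinoids, and let $\mathsf{A}^1_K$ (the Berkovich projective line) be its separated completion: its points are the minimal Cauchy filters on $\mathbb{P}^1_K$, and the sets $\hat V(\mathcal S)=\{\mathcal S' : \mathcal S\text{ and }\mathcal S'\text{ have a common member }Y\text{ with }Y\times Y\subset V\}$,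 $V$ an entourage, form a neighbourhood base at $\mathcal S$. For $Y\subset\mathbb{P}^1_K$ put $\hat Y=\{\mathcal S\in\mathsf{A}^1_K : Y\in\mathcal S\}$. The convergent minimal Cauchy filters are identified with the points of $\mathbb{P}^1_K$. For a non-convergent $\mathcal S$, let $B_{\mathcal S}$ be the intersection of all balls of $K$ that belong to $\mathcal S$; the point $\mathcal S$ is rational if $B_{\mathcal S}$ is a closed ball of $K$, irrational if $B_{\mathcal S}$ is an irrational ball of $K$, and singular if $B_{\mathcal S}=\emptyset$. For $\mathcal S$ rational or irrational, let $\pi(\mathcal S)$ be the set of all open or irrational balls $B$ of $\mathbb{P}^1_K$ such that, $D$ denoting the one of $B$ and $\mathbb{P}^1_K\setminus B$ that is contained in $K$, the closed or irrational ball of $K$ containing $D$ and of the same diameter as $D$ is $B_{\mathcal S}$. Then, for every point $\mathcal S$ of $\mathsf{A}^1_K$: 1. If $\mathcal S$ is rational or irrational, the connected components of $\mathsf{A}^1_K\setminus\{\mathcal S\}$ are exactly the sets $\hat B$ with $B\in\pi(\mathcal S)$. 2. If $\mathcal S$ is singular or belongs to $\mathbb{P}^1_K$, then $\mathsf{A}^1_K\setminus\{\mathcal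 S\}$ is connected. -/

import Mathlib

namespace BerkovichLine

section Balls

variable (K : Type*) [NormedField K]

/-- The value group `|K^*|`, as a set of (positive) real numbers. -/
def valueGroup : Set ℝ := {r | ∃ z : K, z ≠ 0 ∧ ‖z‖ = r}

/-- The projective line: the set of lines through the origin of `K × K`. -/
abbrev P1 : Type _ := Projectivization K (K × K)

variable {K}

/-- The embedding `x ↦ [x : 1]` of `K` in the projective line. Its image is the complement of
`∞ = [1 : 0]`. -/
def ofField (x : K) : P1 K :=
  Projectivization.mk K ((x, 1) : K × K) (fun h => one_ne_zero (congrArg Prod.snd h))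

/-- Open balls of `K`: the radius is in the value group. -/
def IsOpenBallK (B : Set K) : Prop :=
  ∃ a : K, ∃ r ∈ valueGroup K, B = {z | ‖z - a‖ < r}

/-- Closed balls of `K`: the radius is in the value group. -/
def IsClosedBallK (B : Set K) : Prop :=
  ∃ a : K, ∃ r ∈ valueGroup K, B = {z | ‖z - a‖ ≤ r}

/-- Irrational balls of `K`: the radius is positive and not in the value group (so that `<` and `≤`
give the same set). -/
def IsIrrationalBallK (B : Set K) : Prop :=
  ∃ a : K, ∃ r : ℝ, 0 < r ∧ r ∉ valueGroup K ∧ B = {z | ‖z - a‖ < r}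

/-- Balls of `K`, of any of the three kinds. -/
def IsBallK (B : Set K) : Prop :=
  IsOpenBallK B ∨ IsClosedBallK B ∨ IsIrrationalBallK B

/-- Open balls of the projective line: open balls of `K`, and complements of closed balls
of `K`. -/
def IsOpenBall (B : Set (P1 K)) : Prop :=
  (∃ D : Set K, IsOpenBallK D ∧ B = ofField '' D) ∨
    (∃ D : Set K, IsClosedBallK D ∧ B = (ofField '' D)ᶜ)

/-- Irrational balls of the projective line: irrational balls of `K` and their complements. -/
def IsIrrationalBall (B : Set (P1 K)) : Prop :=
  ∃ D : Set K, IsIrrationalBallK D ∧ (B = ofField '' D ∨ B = (ofField '' D)ᶜ)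

/-- Open affinoids: finite intersections of open balls of the projective line (the whole projective
line is the empty intersection). -/
def IsOpenAffinoid (Y : Set (P1 K)) : Prop :=
  ∃ s : Set (Set (P1 K)), s.Finite ∧ (∀ B ∈ s, IsOpenBall B) ∧ Y = ⋂₀ s

/-- Finite covers of the projective line by open affinoids. -/
def IsFiniteAffinoidCover (C : Set (Set (P1 K))) : Prop :=
  C.Finite ∧ (∀ Y ∈ C, IsOpenAffinoid Y) ∧ ⋃₀ C = Set.univ

/-- `V(C)`, the union of the squares `Y × Y` for `Y` in `C`. -/
def coverEntourage (C : Set (Set (P1 K))) : Set (P1 K × P1 K) := ⋃ Y ∈ C, Y ×ˢ Y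

theorem IsOpenAffinoid.inter {Y Y' : Set (P1 K)} (h : IsOpenAffinoid Y) (h' : IsOpenAffinoid Y') :
    IsOpenAffinoid (Y ∩ Y') := by
  obtain ⟨s, hs, hB, rfl⟩ := h
  obtain ⟨s', hs', hB', rfl⟩ := h'
  refine ⟨s ∪ s', hs.union hs', ?_, (Set.sInter_union s s').symm⟩
  rintro B (hB1 | hB1)
  exacts [hB B hB1, hB' B hB1]

theorem isFiniteAffinoidCover_univ : IsFiniteAffinoidCover ({Set.univ} : Set (Set (P1 K))) := by
  refine ⟨Set.finite_singleton _, ?_, Set.sUnion_singleton _⟩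
  rintro Y rfl
  exact ⟨∅, Set.finite_empty, fun B hB => hB.elim, Set.sInter_empty.symm⟩

theorem IsFiniteAffinoidCover.inter {C C' : Set (Set (P1 K))} (h : IsFiniteAffinoidCover C)
    (h' : IsFiniteAffinoidCover C') :
    IsFiniteAffinoidCover (Set.image2 (fun Y Y' => Y ∩ Y') C C') := by
  refine ⟨h.1.image2 _ h'.1, ?_, ?_⟩
  · rintro _ ⟨Y, hY, Y', hY', rfl⟩
    exact (h.2.1 Y hY).inter (h'.2.1 Y' hY')
  · refine Set.eq_univ_of_forall fun x => ?_
    obtain ⟨Y, hY, hx⟩ : x ∈ ⋃₀ C := h.2.2 ▸ Set.mem_univ x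
    obtain ⟨Y', hY', hx'⟩ : x ∈ ⋃₀ C' := h'.2.2 ▸ Set.mem_univ x
    exact ⟨Y ∩ Y', ⟨Y, hY, Y', hY', rfl⟩, hx, hx'⟩

variable (K) in
/-- The uniform structure of finite covers by open affinoids: an entourage is a set of pairs that
contains `V(C)` for some finite cover `C` by open affinoids. -/
def entourages : Filter (P1 K × P1 K) where
  sets := {V | ∃ C, IsFiniteAffinoidCover C ∧ coverEntourage C ⊆ V}
  univ_sets := ⟨_, isFiniteAffinoidCover_univ, Set.subset_univ _⟩
  sets_of_superset := fun ⟨C, hC, h⟩ hVW => ⟨C, hC, h.trans hVW⟩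
  inter_sets := by
    rintro V V' ⟨C, hC, h⟩ ⟨C', hC', h'⟩
    refine ⟨_, hC.inter hC', ?_⟩
    intro p hp
    simp only [coverEntourage, Set.mem_iUnion] at hp
    obtain ⟨_, ⟨Y, hY, Y', hY', rfl⟩, hp1, hp2⟩ := hp
    refine ⟨h ?_, h' ?_⟩
    · exact Set.mem_biUnion hY ⟨hp1.1, hp2.1⟩
    · exact Set.mem_biUnion hY' ⟨hp1.2, hp2.2⟩

/-- Cauchy filters: proper filters with a `V`-small member for every entourage `V`. -/
def IsCauchy (F : Filter (P1 K)) : Prop :=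
  F.NeBot ∧ ∀ V ∈ entourages K, ∃ Y ∈ F, Y ×ˢ Y ⊆ V

end Balls

/-- The points of the Berkovich projective line are the minimal Cauchy filters on the projective
line. Minimality is with respect to inclusion of collections of sets; Mathlib orders filters the
other way round (`F ≤ G` says that every member of `G` is one of `F`), whence `Maximal`. -/
def Ber (K : Type*) [NormedField K] : Type _ := {F : Filter (P1 K) // Maximal IsCauchy F}

variable {K : Type*} [NormedField K]

/-- The entourage `V̂` of the completion: pairs of points with a common `V`-small member. -/
def Ber.entourage (V : Set (P1 K × P1 K)) : Set (Ber K × Ber K) :=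
  {p | ∃ Y, Y ∈ p.1.1 ∧ Y ∈ p.2.1 ∧ Y ×ˢ Y ⊆ V}

/-- The topology of the separated completion: a set is open when, with each of its points `S`, it
contains the set `V̂(S)` for some entourage `V` of the projective line. -/
instance : TopologicalSpace (Ber K) where
  IsOpen O := ∀ S ∈ O, ∃ V ∈ entourages K, {T | (S, T) ∈ Ber.entourage V} ⊆ O
  isOpen_univ := fun _ _ => ⟨Set.univ, Filter.univ_mem, Set.subset_univ _⟩
  isOpen_inter := by
    rintro O O' h h' S ⟨hS, hS'⟩
    obtain ⟨V, hV, hVO⟩ := h S hS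
    obtain ⟨V', hV', hVO'⟩ := h' S hS'
    refine ⟨V ∩ V', Filter.inter_mem hV hV', ?_⟩
    rintro T ⟨Y, hY1, hY2, hY⟩
    exact ⟨hVO ⟨Y, hY1, hY2, hY.trans Set.inter_subset_left⟩,
      hVO' ⟨Y, hY1, hY2, hY.trans Set.inter_subset_right⟩⟩
  isOpen_sUnion := by
    rintro 𝒪 h S ⟨O, hO, hS⟩
    obtain ⟨V, hV, hVO⟩ := h O hO S hS
    exact ⟨V, hV, hVO.trans (Set.subset_sUnion_of_mem hO)⟩

namespace Ber

/-- `Ŷ`, the set of points that, as filters, have `Y` as a member. -/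
def hat (Y : Set (P1 K)) : Set (Ber K) := {S | Y ∈ S.1}

/-- The points of the projective line, inside its completion: the filters that converge to some
point `x`, i.e. contain every neighbourhood `V(x)` of `x`. -/
def IsClassical (S : Ber K) : Prop :=
  ∃ x : P1 K, ∀ V ∈ entourages K, {y | (x, y) ∈ V} ∈ S.1

/-- The intersection of all the balls of `K` that are members of the filter `S`. -/
def core (S : Ber K) : Set K := ⋂₀ {D : Set K | IsBallK D ∧ ofField '' D ∈ S.1}

/-- Rational points: the non-convergent filters whose balls of `K` intersect in a closed ball. -/
def IsRational (S : Ber K) : Prop := ¬ S.IsClassical ∧ IsClosedBallK S.core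

/-- Irrational points: the non-convergent filters whose balls of `K` intersect in an irrational
ball. -/
def IsIrrational (S : Ber K) : Prop := ¬ S.IsClassical ∧ IsIrrationalBallK S.core

/-- Singular points: the non-convergent filters whose balls of `K` have empty intersection. -/
def IsSingular (S : Ber K) : Prop := ¬ S.IsClassical ∧ S.core = ∅

/-- `S` is the point determined by the ball `B` of the projective line: writing `D` for the one of
`B` and its complement that lies in `K`, the point `S` is the rational or irrational point given by
the closed or irrational ball of `K` that contains `D` and has the same diameter as `D`. -/
def IsDeterminedBy (S : Ber K) (B : Set (P1 K)) : Prop :=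
  ∃ D : Set K, (B = ofField '' D ∨ B = (ofField '' D)ᶜ) ∧
    (S.IsRational ∨ S.IsIrrational) ∧ D ⊆ S.core ∧ Metric.diam S.core = Metric.diam D

/-- `π(S)`: the open or irrational balls of the projective line that determine the point `S`. -/
def directions (S : Ber K) : Set (Set (P1 K)) :=
  {B | (IsOpenBall B ∨ IsIrrationalBall B) ∧ S.IsDeterminedBy B}

end Ber

end BerkovichLine

/-! Send a point `S` to its coordinates `a ↦ |S - a|`, the limits along the filter of the distances
to the elements `a` of `K`. This identifies the Berkovich line with the closure of the projective
line in the product `[0, ∞]^K`. Density of the value group makes every Cauchy filter converge in the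
product (`IsCauchy.exists_tendsto`); infinitude of the residue field makes every filter converging
there Cauchy (`exists_mem_cover_of_tendsto`, `isCauchy_of_tendsto`). So the minimal Cauchy filters
are the traces of neighbourhood filters (`maximal_isCauchy_comap`), and the topology is induced from
the product (`isInducing_coord`).

In the product, `t ↦ cone x t` is a path from the point `x` to `∞`. Since cones are dense in every
open set, following these paths shows that `{|T - a| < r}` and `{r < |T - a|}` are connected
(`isPreconnected_coord_lt`, `isPreconnected_lt_coord`).

Removing a point then leaves unions of such sets. If `S` is rational or irrational with core the
ball of centre `a` and radius `r`, its coordinates are `cone a r`, and its complement is partitioned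
into the open connected sets `{|T - c| < r}`, for `c` in the core, and `{r < |T - a|}`. If `S` is
classical, its complement is one set of this kind; if `S` is singular, it is a union of sets `{R <
|T - c|}` that all contain `∞`. -/

namespace BerkovichLine

open Filter Topology ENNReal Set

/-! ### Norms and residues: consequences of the two hypotheses on the field. -/

section Field

variable {K : Type*} [NormedField K]

theorem norm_lt_iff_enorm_lt_ofReal {z : K} {r : ℝ} : ‖z‖ < r ↔ ‖z‖ₑ < ENNReal.ofReal r := by
  rw [← ofReal_norm, ENNReal.ofReal_lt_ofReal_iff_of_nonneg (norm_nonneg z)]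

theorem norm_le_iff_enorm_le_ofReal {z : K} {r : ℝ} (hr : 0 ≤ r) :
    ‖z‖ ≤ r ↔ ‖z‖ₑ ≤ ENNReal.ofReal r := by
  rw [← ofReal_norm, ENNReal.ofReal_le_ofReal_iff hr]

theorem enorm_le_enorm_iff_norm_le {z w : K} : ‖z‖ₑ ≤ ‖w‖ₑ ↔ ‖z‖ ≤ ‖w‖ := by
  rw [norm_le_iff_enorm_le_ofReal (norm_nonneg w), ofReal_norm]

theorem norm_sub_le_max [IsUltrametricDist K] (a b c : K) :
    ‖a - c‖ ≤ max ‖a - b‖ ‖b - c‖ := by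
  simpa only [dist_eq_norm] using IsUltrametricDist.dist_triangle_max a b c

theorem enorm_sub_le_max [IsUltrametricDist K] (a b c : K) :
    ‖a - c‖ₑ ≤ max ‖a - b‖ₑ ‖b - c‖ₑ := by
  rw [← ofReal_norm, ← ofReal_norm, ← ofReal_norm, ← ENNReal.ofReal_max]
  exact ENNReal.ofReal_le_ofReal (norm_sub_le_max a b c)

variable (K) in
/-- The absolute values of the nonzero elements of `K` are dense. -/
def HasDenseNorms : Prop :=
  ∀ ⦃p q : ℝ≥0∞⦄, p < q → ∃ w : K, w ≠ 0 ∧ p < ‖w‖ₑ ∧ ‖w‖ₑ < q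

variable (K) in
/-- No closed ball is covered by finitely many open balls of the same radius. -/
def HasManyDirections : Prop :=
  ∀ (w a : K) (s : Set K), w ≠ 0 → s.Finite → ∃ z : K, ‖z - a‖ₑ ≤ ‖w‖ₑ ∧ ∀ c ∈ s, ‖w‖ₑ ≤ ‖z - c‖ₑ

/-- Without norms slightly above 1, taking quotients shows that each element of the value group is
alone in a multiplicative interval around it, so the group is discrete. -/
theorem exists_norm_one_lt_of_not_discrete (hval : ¬ DiscreteTopology (valueGroup K))
    {ε : ℝ} (hε : 0 < ε) : ∃ w : K, w ≠ 0 ∧ 0 < Real.log ‖w‖ ∧ Real.log ‖w‖ < ε := by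
  by_contra! H
  apply hval
  rw [discreteTopology_subtype_iff]
  rintro x ⟨z, hz, rfl⟩
  have hz0 : 0 < ‖z‖ := norm_pos_iff.2 hz
  have hn : Ioo (‖z‖ * Real.exp (-ε)) (‖z‖ * Real.exp ε) ∈ 𝓝 ‖z‖ := by
    apply Ioo_mem_nhds
    · exact mul_lt_of_lt_one_right hz0 (by
      rw [← Real.exp_zero]; exact Real.exp_lt_exp.2 (by linarith))
    · exact lt_mul_of_one_lt_right hz0 (Real.one_lt_exp_iff.2 hε)
  rw [← empty_mem_iff_bot]
  refine mem_of_superset (inter_mem (mem_inf_of_left (inter_mem (mem_nhdsWithin_of_mem_nhds hn)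
    self_mem_nhdsWithin)) (mem_inf_of_right (mem_principal_self _))) ?_
  rintro y ⟨⟨⟨h1, h2⟩, hne⟩, v, hv, rfl⟩
  have hv0 : 0 < ‖v‖ := norm_pos_iff.2 hv
  have l1 : Real.log ‖z‖ - ε < Real.log ‖v‖ := by
    have := Real.log_lt_log (by positivity) h1
    rwa [Real.log_mul hz0.ne' (Real.exp_pos _).ne', Real.log_exp] at this
  have l2 : Real.log ‖v‖ < Real.log ‖z‖ + ε := by
    have := Real.log_lt_log hv0 h2
    rwa [Real.log_mul hz0.ne' (Real.exp_pos _).ne', Real.log_exp] at this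
  have hne' : Real.log ‖v‖ ≠ Real.log ‖z‖ := fun h =>
    hne (Real.log_injOn_pos hv0 hz0 h)
  rcases lt_or_gt_of_ne hne' with h | h
  · have := H (z / v) (div_ne_zero hz hv)
    rw [norm_div, Real.log_div hz0.ne' hv0.ne'] at this
    linarith [this (by linarith)]
  · have := H (v / z) (div_ne_zero hv hz)
    rw [norm_div, Real.log_div hv0.ne' hz0.ne'] at this
    linarith [this (by linarith)]

/-- The logarithms of the norms form an additive subgroup of the reals in which 0 is not isolated,
and such a subgroup is dense. -/
theorem hasDenseNorms_of_not_discrete (hval : ¬ DiscreteTopology (valueGroup K)) :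
    HasDenseNorms K := by
  let S : AddSubgroup ℝ :=
    { carrier := {x | ∃ w : K, w ≠ 0 ∧ Real.log ‖w‖ = x}
      zero_mem' := ⟨1, one_ne_zero, by simp⟩
      add_mem' := by
        rintro _ _ ⟨v, hv, rfl⟩ ⟨w, hw, rfl⟩
        exact ⟨v * w, mul_ne_zero hv hw, by
          rw [norm_mul, Real.log_mul (norm_ne_zero_iff.2 hv) (norm_ne_zero_iff.2 hw)]⟩
      neg_mem' := by
        rintro _ ⟨v, hv, rfl⟩
        exact ⟨v⁻¹, inv_ne_zero hv, by rw [norm_inv, Real.log_inv]⟩ }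
  have hS : Dense (S : Set ℝ) := by
    apply AddSubgroup.dense_of_not_isolated_zero
    intro ε hε
    obtain ⟨w, hw, h1, h2⟩ := exists_norm_one_lt_of_not_discrete hval hε
    exact ⟨_, ⟨w, hw, rfl⟩, h1, h2⟩
  intro p q hpq
  obtain ⟨s, hs0, hps, hsq⟩ := ENNReal.lt_iff_exists_real_btwn.1 hpq
  obtain ⟨t, -, hst, htq⟩ := ENNReal.lt_iff_exists_real_btwn.1 hsq
  have hst' : s < t := (ENNReal.ofReal_lt_ofReal_iff_of_nonneg hs0).1 hst
  have ht0 : 0 < t := hs0.trans_lt hst'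
  obtain ⟨m, hsm, hmt⟩ := exists_between hst'
  have hm0 : 0 < m := hs0.trans_lt hsm
  obtain ⟨_, ⟨w, hw, rfl⟩, h1, h2⟩ := hS.exists_between (Real.log_lt_log hm0 hmt)
  have hw0 := norm_pos_iff.2 hw
  refine ⟨w, hw, hps.trans ?_, lt_trans ?_ htq⟩
  · rw [← ofReal_norm, ENNReal.ofReal_lt_ofReal_iff hw0]
    exact hsm.trans ((Real.log_lt_log_iff hm0 hw0).1 h1)
  · rw [← ofReal_norm, ENNReal.ofReal_lt_ofReal_iff ht0]
    exact (Real.log_lt_log_iff hw0 ht0).1 h2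

theorem exists_norm_le_one_of_infinite_residueField [IsUltrametricDist K]
    (hres : Infinite (IsLocalRing.ResidueField (NormedField.valuation (K := K)).valuationSubring))
    {s : Set K} (hs : s.Finite) : ∃ u : K, ‖u‖ ≤ 1 ∧ ∀ c ∈ s, 1 ≤ ‖u - c‖ := by
  set O := (NormedField.valuation (K := K)).valuationSubring with hO
  have memO : ∀ x : K, x ∈ O ↔ ‖x‖ ≤ 1 := by
    intro x
    rw [hO, Valuation.mem_valuationSubring_iff, NormedField.valuation_apply]
    exact Iff.rfl
  have hfin : (IsLocalRing.residue O '' (Subtype.val ⁻¹' s)).Finite :=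
    (hs.preimage Subtype.val_injective.injOn).image _
  obtain ⟨y, hy⟩ := hfin.infinite_compl.nonempty
  obtain ⟨u, rfl⟩ := IsLocalRing.residue_surjective y
  refine ⟨u, (memO _).1 u.2, fun c hc => ?_⟩
  by_contra! hlt
  -- Centres outside the valuation ring need no avoiding: an element at distance less than 1 from
  -- `u` is itself integral.
  have hcO : c ∈ O := by
    have h : (u : K) - c ∈ O := (memO _).2 hlt.le
    simpa using O.sub_mem u.2 h
  refine hy ⟨⟨c, hcO⟩, hc, ?_⟩
  rw [eq_comm, ← sub_eq_zero, ← map_sub, IsLocalRing.residue_eq_zero_iff,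
    IsLocalRing.mem_maximalIdeal, mem_nonunits_iff]
  rintro ⟨v, hv⟩
  have h1 : ((v : O) : K) * ((v⁻¹ : Oˣ) : O) = 1 := by
    exact_mod_cast congrArg (Subtype.val) (Units.mul_inv v)
  have h2 : ‖((v : O) : K)‖ < 1 := by
    rw [hv]; exact hlt
  have h3 : ‖(((v⁻¹ : Oˣ) : O) : K)‖ ≤ 1 := (memO _).1 ((v⁻¹ : Oˣ) : O).2
  have h4 := congrArg norm h1
  rw [norm_mul, norm_one] at h4
  nlinarith [norm_nonneg ((v : O) : K), norm_nonneg (((v⁻¹ : Oˣ) : O) : K)]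

theorem hasManyDirections_of_infinite_residueField [IsUltrametricDist K]
    (hres : Infinite (IsLocalRing.ResidueField (NormedField.valuation (K := K)).valuationSubring)) :
    HasManyDirections K := by
  intro w a s hw hs
  obtain ⟨u, hu, hus⟩ := exists_norm_le_one_of_infinite_residueField hres
    (hs.image fun c => (c - a) / w)
  have hw0 := norm_pos_iff.2 hw
  refine ⟨a + w * u, ?_, fun c hc => ?_⟩
  · rw [enorm_le_enorm_iff_norm_le, add_sub_cancel_left, norm_mul]
    exact mul_le_of_le_one_right hw0.le hu
  · have h := hus _ ⟨c, hc, rfl⟩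
    have e : a + w * u - c = w * (u - (c - a) / w) := by field_simp; ring
    rw [enorm_le_enorm_iff_norm_le, e, norm_mul]
    exact le_mul_of_one_le_right hw0.le h

end Field

/-! ### Distances on the projective line, with balls as their sublevel and superlevel sets. -/

section Line

variable {K : Type*} [NormedField K]

theorem ofField_injective : Function.Injective (ofField : K → P1 K) := by
  intro x y h
  obtain ⟨c, hc⟩ := (Projectivization.mk_eq_mk_iff' K _ _ _ _).1 h
  have h2 : c = 1 := by simpa using congrArg Prod.snd hc
  simpa [h2] using (congrArg Prod.fst hc).symm

theorem exists_notMem_range_ofField : ∃ p : P1 K, p ∉ range (ofField : K → P1 K) := by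
  refine ⟨Projectivization.mk K ((1, 0) : K × K) fun h => one_ne_zero (congrArg Prod.fst h), ?_⟩
  rintro ⟨x, h⟩
  obtain ⟨c, hc⟩ := (Projectivization.mk_eq_mk_iff' K _ _ _ _).1 h
  have h1 : c = x := by simpa using congrArg Prod.fst hc
  have h2 : (0 : K) = 1 := by simpa using congrArg Prod.snd hc
  exact zero_ne_one h2

/-- The distance `|p - a|` of a point of the projective line to `a : K`, infinite for `p = ∞`. -/
noncomputable def edistTo (p : P1 K) (a : K) : ℝ≥0∞ := ⨅ (z : K) (_ : ofField z = p), ‖z - a‖ₑ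

@[simp]
theorem edistTo_ofField (z a : K) : edistTo (ofField z) a = ‖z - a‖ₑ := by
  refine le_antisymm (iInf₂_le (f := fun y (_ : ofField y = ofField z) => ‖y - a‖ₑ) z rfl)
    (le_iInf₂ fun y hy => ?_)
  rw [ofField_injective hy]

theorem edistTo_eq_top {p : P1 K} (hp : p ∉ range (ofField : K → P1 K)) (a : K) :
    edistTo p a = ⊤ := by
  refine top_le_iff.1 (le_iInf₂ fun y hy => (hp ⟨y, hy⟩).elim)

theorem edistTo_le_max [IsUltrametricDist K] (p : P1 K) (a b : K) :
    edistTo p a ≤ max (edistTo p b) ‖b - a‖ₑ := by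
  by_cases hp : p ∈ range (ofField : K → P1 K)
  · obtain ⟨z, rfl⟩ := hp
    simpa using enorm_sub_le_max z b a
  · simp [edistTo_eq_top hp]

theorem enorm_sub_le_max_edistTo [IsUltrametricDist K] (p : P1 K) (a b : K) :
    ‖a - b‖ₑ ≤ max (edistTo p a) (edistTo p b) := by
  by_cases hp : p ∈ range (ofField : K → P1 K)
  · obtain ⟨z, rfl⟩ := hp
    simpa [enorm_sub_rev] using enorm_sub_le_max a z b
  · simp [edistTo_eq_top hp]

theorem image_ball (a : K) (r : ℝ) :
    ofField '' {z : K | ‖z - a‖ < r} = {p | edistTo p a < ENNReal.ofReal r} := by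
  ext p
  constructor
  · rintro ⟨z, hz, rfl⟩
    simpa [← norm_lt_iff_enorm_lt_ofReal] using hz
  · intro h
    by_cases hp : p ∈ range (ofField : K → P1 K)
    · obtain ⟨z, rfl⟩ := hp
      exact ⟨z, by simpa [← norm_lt_iff_enorm_lt_ofReal] using h, rfl⟩
    · simp [edistTo_eq_top hp] at h

theorem image_closedBall (a : K) {r : ℝ} (hr : 0 ≤ r) :
    ofField '' {z : K | ‖z - a‖ ≤ r} = {p | edistTo p a ≤ ENNReal.ofReal r} := by
  ext p
  constructor
  · rintro ⟨z, hz, rfl⟩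
    simpa [← norm_le_iff_enorm_le_ofReal hr] using hz
  · intro h
    by_cases hp : p ∈ range (ofField : K → P1 K)
    · obtain ⟨z, rfl⟩ := hp
      exact ⟨z, by simpa [← norm_le_iff_enorm_le_ofReal hr] using h, rfl⟩
    · simp [edistTo_eq_top hp] at h

theorem compl_image_closedBall (a : K) {r : ℝ} (hr : 0 ≤ r) :
    (ofField '' {z : K | ‖z - a‖ ≤ r})ᶜ = {p | ENNReal.ofReal r < edistTo p a} := by
  rw [image_closedBall a hr]
  ext p
  simp

theorem isOpenBall_iff {B : Set (P1 K)} : IsOpenBall B ↔ ∃ a w : K, w ≠ 0 ∧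
    (B = {p | edistTo p a < ‖w‖ₑ} ∨ B = {p | ‖w‖ₑ < edistTo p a}) := by
  constructor
  · rintro (⟨_, ⟨a, _, ⟨w, hw, rfl⟩, rfl⟩, rfl⟩ | ⟨_, ⟨a, _, ⟨w, hw, rfl⟩, rfl⟩, rfl⟩)
    · exact ⟨a, w, hw, .inl (by rw [image_ball, ofReal_norm])⟩
    · exact ⟨a, w, hw, .inr (by rw [compl_image_closedBall a (norm_nonneg w), ofReal_norm])⟩
  · rintro ⟨a, w, hw, rfl | rfl⟩
    · exact .inl ⟨_, ⟨a, _, ⟨w, hw, rfl⟩, rfl⟩, by rw [image_ball, ofReal_norm]⟩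
    · exact .inr ⟨_, ⟨a, _, ⟨w, hw, rfl⟩, rfl⟩, by
        rw [compl_image_closedBall a (norm_nonneg w), ofReal_norm]⟩

theorem IsOpenBall.isOpenAffinoid {B : Set (P1 K)} (hB : IsOpenBall B) : IsOpenAffinoid B :=
  ⟨{B}, finite_singleton B, by rintro _ rfl; exact hB, (sInter_singleton B).symm⟩

theorem false_of_edistTo_lt_mem_of_lt_edistTo_mem {F : Filter (P1 K)} [F.NeBot] {a : K}
    {r s : ℝ≥0∞} (hrs : r ≤ s) (h : {p | edistTo p a < r} ∈ F) (h' : {p | s < edistTo p a} ∈ F) :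
    False := by
  obtain ⟨p, hp, hp'⟩ := (Filter.Eventually.and h h').exists
  exact (hp.trans_le hrs).not_gt hp'

/-- A set small for this cover lies in one of the two balls, so these entourages let a Cauchy filter
decide on which side of a gap the distance to `a` falls. -/
theorem coverEntourage_pair_mem (a : K) {v w : K} (hv : v ≠ 0) (hw : w ≠ 0) (hvw : ‖v‖ₑ < ‖w‖ₑ) :
    coverEntourage {{p | edistTo p a < ‖w‖ₑ}, {p | ‖v‖ₑ < edistTo p a}} ∈ entourages K := by
  refine ⟨_, ⟨by simp, ?_, ?_⟩, Subset.rfl⟩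
  · rintro Y (rfl | rfl)
    · exact (isOpenBall_iff.2 ⟨a, w, hw, .inl rfl⟩).isOpenAffinoid
    · exact (isOpenBall_iff.2 ⟨a, v, hv, .inr rfl⟩).isOpenAffinoid
  · refine eq_univ_of_forall fun p => ?_
    rw [sUnion_pair]
    exact (lt_or_ge (edistTo p a) ‖w‖ₑ).imp id fun h => hvw.trans_le h

theorem subset_or_subset_of_prod_subset {Y A B : Set (P1 K)}
    (h : Y ×ˢ Y ⊆ coverEntourage {A, B}) : Y ⊆ A ∨ Y ⊆ B := by
  by_contra! hc
  obtain ⟨⟨y, hy, hyA⟩, z, hz, hzB⟩ := And.imp not_subset.1 not_subset.1 hc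
  have := h (mk_mem_prod hy hz)
  simp only [coverEntourage, mem_insert_iff, mem_singleton_iff, iUnion_iUnion_eq_or_left,
    iUnion_iUnion_eq_left, mem_union, mem_prod] at this
  tauto

theorem prod_subset_coverEntourage {C : Set (Set (P1 K))} {Y : Set (P1 K)} (hY : Y ∈ C) :
    Y ×ˢ Y ⊆ coverEntourage C := fun _ hp => mem_biUnion hY hp

end Line

/-! ### Cauchy filters are the filters along which all distances converge. -/

section CauchyFilters

variable {K : Type*} [NormedField K]

theorem IsCauchy.exists_tendsto (hd : HasDenseNorms K) {F : Filter (P1 K)} (hF : IsCauchy F) :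
    ∃ f, Tendsto edistTo F (𝓝 f) := by
  have := hF.1
  -- Compactness of the product gives a limit along a finer ultrafilter. The two-ball covers then
  -- transfer each strict inequality back to `F`, the wrong alternative being refuted on the
  -- ultrafilter.
  obtain ⟨f, hf⟩ : ∃ f, ((Ultrafilter.of F).map edistTo : Filter (K → ℝ≥0∞)) ≤ 𝓝 f :=
    ⟨_, Ultrafilter.le_nhds_lim _⟩
  have hf' : ∀ a, Tendsto (fun p => edistTo p a) (Ultrafilter.of F : Filter (P1 K)) (𝓝 (f a)) :=
    tendsto_pi_nhds.1 hf
  have key : ∀ a (v w : K), v ≠ 0 → w ≠ 0 → ‖v‖ₑ < ‖w‖ₑ →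
      (∀ᶠ p in F, edistTo p a < ‖w‖ₑ) ∨ ∀ᶠ p in F, ‖v‖ₑ < edistTo p a := by
    intro a v w hv hw hvw
    obtain ⟨Y, hY, hYV⟩ := hF.2 _ (coverEntourage_pair_mem a hv hw hvw)
    exact (subset_or_subset_of_prod_subset hYV).imp (mem_of_superset hY) (mem_of_superset hY)
  refine ⟨f, tendsto_pi_nhds.2 fun a => tendsto_order.2 ⟨fun r hr => ?_, fun r hr => ?_⟩⟩
  · obtain ⟨v, hv, h1, h2⟩ := hd hr
    obtain ⟨w, hw, h3, h4⟩ := hd h2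
    rcases key a v w hv hw h3 with h | h
    · obtain ⟨p, hp, hp'⟩ := (Filter.Eventually.and (Ultrafilter.of_le F h)
        ((tendsto_order.1 (hf' a)).1 _ h4)).exists
      exact (hp.not_gt hp').elim
    · exact h.mono fun p hp => h1.trans hp
  · obtain ⟨w, hw, h1, h2⟩ := hd hr
    obtain ⟨v, hv, h3, h4⟩ := hd h1
    rcases key a v w hv hw h4 with h | h
    · exact h.mono fun p hp => hp.trans h2
    · obtain ⟨p, hp, hp'⟩ := (Filter.Eventually.and (Ultrafilter.of_le F h)
        ((tendsto_order.1 (hf' a)).2 _ h3)).exists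
      exact (hp.not_gt hp').elim

theorem le_max_of_mem_closure [IsUltrametricDist K] {f : K → ℝ≥0∞}
    (hf : f ∈ closure (range (edistTo : P1 K → K → ℝ≥0∞))) (a b : K) :
    f a ≤ max (f b) ‖b - a‖ₑ := by
  have hc : IsClosed {f : K → ℝ≥0∞ | f a ≤ max (f b) ‖b - a‖ₑ} :=
    isClosed_le (continuous_apply a) ((continuous_apply b).max continuous_const)
  exact closure_minimal (range_subset_iff.2 fun p => edistTo_le_max p a b) hc hf

theorem enorm_sub_le_max_of_mem_closure [IsUltrametricDist K] {f : K → ℝ≥0∞}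
    (hf : f ∈ closure (range (edistTo : P1 K → K → ℝ≥0∞))) (a b : K) :
    ‖a - b‖ₑ ≤ max (f a) (f b) := by
  have hc : IsClosed {f : K → ℝ≥0∞ | ‖a - b‖ₑ ≤ max (f a) (f b)} :=
    isClosed_le continuous_const ((continuous_apply a).max (continuous_apply b))
  exact closure_minimal (range_subset_iff.2 fun p => enorm_sub_le_max_edistTo p a b) hc hf

theorem mem_closure_range_of_tendsto {F : Filter (P1 K)} [F.NeBot] {f : K → ℝ≥0∞}
    (h : Tendsto edistTo F (𝓝 f)) : f ∈ closure (range (edistTo : P1 K → K → ℝ≥0∞)) :=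
  mem_closure_of_tendsto h (Eventually.of_forall fun p => mem_range_self p)

/-- Otherwise each affinoid of the cover lies in an open ball that is not in `F`, and it suffices to
find a point outside all these balls. A generic point of a suitable closed ball will do, because
finitely many directions do not exhaust it. -/
theorem exists_mem_cover_of_tendsto [IsUltrametricDist K] (hm : HasManyDirections K)
    {F : Filter (P1 K)} [F.NeBot] {f : K → ℝ≥0∞} (h : Tendsto edistTo F (𝓝 f))
    {C : Set (Set (P1 K))} (hC : IsFiniteAffinoidCover C) : ∃ Y ∈ C, Y ∈ F := by
  by_contra! H
  have hcl := mem_closure_range_of_tendsto h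
  have hlim := fun a => tendsto_order.1 (tendsto_pi_nhds.1 h a)
  have hball : ∀ Y ∈ C, ∃ a w : K, w ≠ 0 ∧ ((Y ⊆ {p | edistTo p a < ‖w‖ₑ} ∧ ‖w‖ₑ ≤ f a) ∨
      (Y ⊆ {p | ‖w‖ₑ < edistTo p a} ∧ f a ≤ ‖w‖ₑ)) := by
    intro Y hY
    obtain ⟨s, hs, hB, rfl⟩ := hC.2.1 Y hY
    have : ∃ B ∈ s, B ∉ F := by
      by_contra! hs'
      exact H _ hY ((sInter_mem hs).2 hs')
    obtain ⟨B, hBs, hBF⟩ := this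
    obtain ⟨a, w, hw, rfl | rfl⟩ := isOpenBall_iff.1 (hB B hBs)
    · exact ⟨a, w, hw, .inl ⟨sInter_subset_of_mem hBs,
        not_lt.1 fun hlt => hBF ((hlim a).2 _ hlt)⟩⟩
    · exact ⟨a, w, hw, .inr ⟨sInter_subset_of_mem hBs,
        not_lt.1 fun hlt => hBF ((hlim a).1 _ hlt)⟩⟩
  choose! a w hw hB using hball
  have hcov : ∀ p : P1 K, ∃ Y ∈ C, p ∈ Y := fun p => by
    have : p ∈ ⋃₀ C := hC.2.2 ▸ mem_univ p
    simpa using this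
  -- The smallest radius among those with `f (a Y) ≤ ‖w Y‖ₑ`. There is one, because the affinoid
  -- containing `∞` must lie in the complement of a closed ball.
  obtain ⟨Y₀, ⟨hY₀, hf₀⟩, hmin⟩ := exists_min_image {Y ∈ C | f (a Y) ≤ ‖w Y‖ₑ}
      (fun Y => ‖w Y‖ₑ) (hC.1.subset (sep_subset _ _)) (by
    obtain ⟨p, hp⟩ := exists_notMem_range_ofField (K := K)
    obtain ⟨Y, hY, hpY⟩ := hcov p
    rcases hB Y hY with h | h
    · have := h.1 hpY
      simp [edistTo_eq_top hp] at this
    · exact ⟨Y, hY, h.2⟩)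
  obtain ⟨z, hz, hza⟩ := hm (w Y₀) (a Y₀) (a '' C) (hw Y₀ hY₀) (hC.1.image a)
  obtain ⟨Y, hY, hzY⟩ := hcov (ofField z)
  have hzY' := hza _ ⟨Y, hY, rfl⟩
  rcases hB Y hY with ⟨h1, h2⟩ | ⟨h1, h2⟩
  · have h3 : ‖z - a Y‖ₑ < ‖w Y‖ₑ := by simpa using h1 hzY
    have h4 := le_max_of_mem_closure hcl (a Y) (a Y₀)
    have h5 := enorm_sub_le_max (a Y₀) z (a Y)
    rw [enorm_sub_rev (a Y₀) z] at h5
    have h6 : f (a Y) ≤ ‖z - a Y‖ₑ :=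
      h4.trans (max_le (hf₀.trans hzY') (h5.trans (max_le (hz.trans hzY') le_rfl)))
    exact (h3.trans_le h2).not_ge h6
  · have h3 : ‖w Y‖ₑ < ‖z - a Y‖ₑ := by simpa using h1 hzY
    have h4 := hmin Y ⟨hY, h2⟩
    have h5 := enorm_sub_le_max z (a Y₀) (a Y)
    have h6 := enorm_sub_le_max_of_mem_closure hcl (a Y₀) (a Y)
    exact h3.not_ge (h5.trans (max_le (hz.trans h4) (h6.trans (max_le (hf₀.trans h4) h2))))

theorem isCauchy_of_tendsto [IsUltrametricDist K] (hm : HasManyDirections K)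
    {F : Filter (P1 K)} [hF : F.NeBot] {f : K → ℝ≥0∞} (h : Tendsto edistTo F (𝓝 f)) :
    IsCauchy F := by
  refine ⟨hF, ?_⟩
  rintro V ⟨C, hC, hCV⟩
  obtain ⟨Y, hY, hYF⟩ := exists_mem_cover_of_tendsto hm h hC
  exact ⟨Y, hYF, (prod_subset_coverEntourage hY).trans hCV⟩

/-- Among the filters with limit `f`, the trace of the neighbourhood filter has the fewest members.
A Cauchy filter with fewer still has a limit of its own, which is `f` by uniqueness of limits. -/
theorem maximal_isCauchy_comap [IsUltrametricDist K] (hd : HasDenseNorms K)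
    (hm : HasManyDirections K) {f : K → ℝ≥0∞}
    (hf : f ∈ closure (range (edistTo : P1 K → K → ℝ≥0∞))) :
    Maximal IsCauchy (comap (edistTo : P1 K → K → ℝ≥0∞) (𝓝 f)) := by
  have : (comap (edistTo : P1 K → K → ℝ≥0∞) (𝓝 f)).NeBot := by
    rw [comap_neBot_iff]
    intro t ht
    obtain ⟨_, h, p, rfl⟩ := mem_closure_iff_nhds.1 hf t ht
    exact ⟨p, h⟩
  refine ⟨isCauchy_of_tendsto hm tendsto_comap, fun G hG hle => ?_⟩
  obtain ⟨g, hg⟩ := hG.exists_tendsto hd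
  have : f = g := tendsto_nhds_unique tendsto_comap (hg.mono_left hle)
  rw [this]
  exact tendsto_iff_comap.1 hg

end CauchyFilters

/-! ### Cones: the points given by balls, as paths in the product. -/

section Cones

variable {K : Type*} [NormedField K]

/-- The function `a ↦ max(t, |x - a|)`, the coordinates of the point given by the ball of centre `x`
and radius `t`. -/
noncomputable def cone (x : K) (t : ℝ≥0∞) : K → ℝ≥0∞ := fun a => max t ‖x - a‖ₑ

theorem continuous_cone (x : K) : Continuous (cone x) :=
  continuous_pi fun _ => continuous_id.max continuous_const

@[simp]
theorem cone_self (x : K) (t : ℝ≥0∞) : cone x t x = t := by simp [cone]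

theorem cone_zero (x : K) : cone x 0 = edistTo (ofField x) := by
  ext a; simp [cone]

theorem cone_top (x : K) : cone x ⊤ = fun _ => ⊤ := by
  ext a; simp [cone]

theorem cone_eq_cone [IsUltrametricDist K] {x y : K} {t : ℝ≥0∞} (h : ‖x - y‖ₑ ≤ t) :
    cone x t = cone y t := by
  ext a
  refine le_antisymm (max_le (le_max_left _ _) ?_) (max_le (le_max_left _ _) ?_)
  · exact (enorm_sub_le_max x y a).trans (max_le_max h le_rfl)
  · rw [enorm_sub_rev] at h
    exact (enorm_sub_le_max y x a).trans (max_le_max h le_rfl)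

/-- Where a coordinate function attains its minimum, the two ultrametric inequalities determine all
its other values. -/
theorem eq_cone_of_forall_le [IsUltrametricDist K] {f : K → ℝ≥0∞}
    (hf : f ∈ closure (range (edistTo : P1 K → K → ℝ≥0∞))) {a : K} (h : ∀ c, f a ≤ f c) :
    f = cone a (f a) := by
  ext c
  refine le_antisymm (le_max_of_mem_closure hf c a) (max_le (h c) ?_)
  exact (enorm_sub_le_max_of_mem_closure hf a c).trans (max_le (h c) le_rfl)

theorem dense_enorm (hd : HasDenseNorms K) : Dense {t : ℝ≥0∞ | ∃ w : K, w ≠ 0 ∧ ‖w‖ₑ = t} :=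
  dense_of_exists_between fun _ _ h =>
    let ⟨w, hw, h1, h2⟩ := hd h
    ⟨_, ⟨w, hw, rfl⟩, h1, h2⟩

/-- For `t` a norm, a generic point of the closed ball has exactly the coordinates of the cone at
any given finite set of centres. Other `t` follow by density and continuity. -/
theorem cone_mem_closure [IsUltrametricDist K] (hd : HasDenseNorms K) (hm : HasManyDirections K)
    (x : K) (t : ℝ≥0∞) : cone x t ∈ closure (range (edistTo : P1 K → K → ℝ≥0∞)) := by
  refine closure_minimal (s := {t : ℝ≥0∞ | ∃ w : K, w ≠ 0 ∧ ‖w‖ₑ = t})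
    (t := cone x ⁻¹' closure (range (edistTo : P1 K → K → ℝ≥0∞))) ?_
    (isClosed_closure.preimage (continuous_cone x)) (dense_enorm hd t)
  rintro _ ⟨w, hw, rfl⟩
  refine mem_closure_iff_nhds.2 fun W hW => ?_
  rw [nhds_pi, Filter.mem_pi] at hW
  obtain ⟨I, hI, u, hu, hIu⟩ := hW
  obtain ⟨z, hz, hzI⟩ := hm w x I hw hI
  refine ⟨edistTo (ofField z), hIu fun c hc => ?_, mem_range_self _⟩
  have : edistTo (ofField z) c = cone x ‖w‖ₑ c := by
    rw [edistTo_ofField]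
    refine le_antisymm ((enorm_sub_le_max z x c).trans (max_le_max hz le_rfl))
      (max_le (hzI c hc) ((enorm_sub_le_max x z c).trans (max_le ?_ le_rfl)))
    rw [enorm_sub_rev]
    exact hz.trans (hzI c hc)
  rw [this]
  exact mem_of_mem_nhds (hu c)

end Cones

namespace Ber

/-! ### The coordinate embedding of the Berkovich line. -/

section Coordinates

variable {K : Type*} [NormedField K]

instance neBot (S : Ber K) : S.1.NeBot := S.2.prop.1

/-- The coordinates of a point: the limits `a ↦ |S - a|` of the distances along the filter. -/
noncomputable def coord (S : Ber K) : K → ℝ≥0∞ := lim (S.1.map edistTo)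

theorem tendsto_coord (hd : HasDenseNorms K) (S : Ber K) : Tendsto edistTo S.1 (𝓝 S.coord) :=
  le_nhds_lim (S.2.prop.exists_tendsto hd)

theorem coord_mem_closure (hd : HasDenseNorms K) (S : Ber K) :
    S.coord ∈ closure (range (edistTo : P1 K → K → ℝ≥0∞)) :=
  mem_closure_range_of_tendsto (S.tendsto_coord hd)

theorem setOf_edistTo_lt_mem (hd : HasDenseNorms K) {S : Ber K} {a : K} {r : ℝ≥0∞}
    (h : S.coord a < r) : {p | edistTo p a < r} ∈ S.1 :=
  (tendsto_order.1 (tendsto_pi_nhds.1 (S.tendsto_coord hd) a)).2 _ h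

theorem setOf_lt_edistTo_mem (hd : HasDenseNorms K) {S : Ber K} {a : K} {r : ℝ≥0∞}
    (h : r < S.coord a) : {p | r < edistTo p a} ∈ S.1 :=
  (tendsto_order.1 (tendsto_pi_nhds.1 (S.tendsto_coord hd) a)).1 _ h

theorem coord_eq_of_tendsto (hd : HasDenseNorms K) {S : Ber K} {f : K → ℝ≥0∞}
    (h : Tendsto edistTo S.1 (𝓝 f)) : S.coord = f :=
  tendsto_nhds_unique (S.tendsto_coord hd) h

theorem continuous_coord (hd : HasDenseNorms K) : Continuous (coord : Ber K → K → ℝ≥0∞) := by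
  refine continuous_pi fun a => OrderTopology.continuous_iff.2 fun r =>
    ⟨fun S hS => ?_, fun S hS => ?_⟩
  · obtain ⟨v, hv, h1, h2⟩ := hd (show r < S.coord a from hS)
    obtain ⟨w, hw, h3, h4⟩ := hd h2
    refine ⟨_, coverEntourage_pair_mem a hv hw h3, ?_⟩
    rintro T ⟨Y, hYS, hYT, hY⟩
    rcases subset_or_subset_of_prod_subset hY with h | h
    · exact (false_of_edistTo_lt_mem_of_lt_edistTo_mem le_rfl (mem_of_superset hYS h)
        (setOf_lt_edistTo_mem hd h4)).elim
    · refine lt_of_lt_of_le h1 (not_lt.1 fun hlt => ?_)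
      exact false_of_edistTo_lt_mem_of_lt_edistTo_mem le_rfl (setOf_edistTo_lt_mem hd hlt)
        (mem_of_superset hYT h)
  · obtain ⟨w, hw, h1, h2⟩ := hd (show S.coord a < r from hS)
    obtain ⟨v, hv, h3, h4⟩ := hd h1
    refine ⟨_, coverEntourage_pair_mem a hv hw h4, ?_⟩
    rintro T ⟨Y, hYS, hYT, hY⟩
    rcases subset_or_subset_of_prod_subset hY with h | h
    · refine lt_of_le_of_lt (not_lt.1 fun hlt => ?_) h2
      exact false_of_edistTo_lt_mem_of_lt_edistTo_mem le_rfl (mem_of_superset hYT h)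
        (setOf_lt_edistTo_mem hd hlt)
    · exact (false_of_edistTo_lt_mem_of_lt_edistTo_mem le_rfl (setOf_edistTo_lt_mem hd h3)
        (mem_of_superset hYS h)).elim

theorem isOpen_coord_lt (hd : HasDenseNorms K) (a : K) (r : ℝ≥0∞) :
    IsOpen {T : Ber K | T.coord a < r} :=
  isOpen_Iio.preimage ((continuous_apply a).comp (continuous_coord hd))

theorem isOpen_lt_coord (hd : HasDenseNorms K) (a : K) (r : ℝ≥0∞) :
    IsOpen {T : Ber K | r < T.coord a} :=
  isOpen_Ioi.preimage ((continuous_apply a).comp (continuous_coord hd))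

variable [IsUltrametricDist K]

theorem coord_le_max (hd : HasDenseNorms K) (S : Ber K) (a b : K) :
    S.coord a ≤ max (S.coord b) ‖b - a‖ₑ :=
  le_max_of_mem_closure (S.coord_mem_closure hd) a b

theorem enorm_sub_le_max_coord (hd : HasDenseNorms K) (S : Ber K) (a b : K) :
    ‖a - b‖ₑ ≤ max (S.coord a) (S.coord b) :=
  enorm_sub_le_max_of_mem_closure (S.coord_mem_closure hd) a b

theorem coord_eq_enorm_sub (hd : HasDenseNorms K) {S : Ber K} {a c : K}
    (h : S.coord c < ‖c - a‖ₑ) : S.coord a = ‖c - a‖ₑ := by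
  refine le_antisymm ((S.coord_le_max hd a c).trans (max_le h.le le_rfl)) ?_
  exact (le_max_iff.1 (S.enorm_sub_le_max_coord hd c a)).resolve_left h.not_ge

theorem enorm_sub_eq_coord (hd : HasDenseNorms K) {S : Ber K} {a c : K}
    (h : S.coord c < S.coord a) : ‖c - a‖ₑ = S.coord a := by
  refine le_antisymm ((S.enorm_sub_le_max_coord hd c a).trans (max_le h.le le_rfl)) ?_
  exact (le_max_iff.1 (S.coord_le_max hd a c)).resolve_left h.not_ge

theorem filter_eq_comap (hd : HasDenseNorms K) (hm : HasManyDirections K)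
    (S : Ber K) : S.1 = comap edistTo (𝓝 S.coord) :=
  le_antisymm (tendsto_iff_comap.1 (S.tendsto_coord hd))
    (S.2.le_of_ge (maximal_isCauchy_comap hd hm (S.coord_mem_closure hd)).prop
      (tendsto_iff_comap.1 (S.tendsto_coord hd)))

theorem coord_injective (hd : HasDenseNorms K) (hm : HasManyDirections K) :
    Function.Injective (coord : Ber K → K → ℝ≥0∞) := fun S T h =>
  Subtype.ext (by rw [S.filter_eq_comap hd hm, T.filter_eq_comap hd hm, h])

theorem exists_coord_eq (hd : HasDenseNorms K) (hm : HasManyDirections K)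
    {f : K → ℝ≥0∞}
    (hf : f ∈ closure (range (edistTo : P1 K → K → ℝ≥0∞))) : ∃ S : Ber K, S.coord = f :=
  ⟨⟨_, maximal_isCauchy_comap hd hm hf⟩, coord_eq_of_tendsto hd tendsto_comap⟩

theorem exists_coord_eq_cone (hd : HasDenseNorms K) (hm : HasManyDirections K)
    (x : K) (t : ℝ≥0∞) : ∃ S : Ber K, S.coord = cone x t :=
  exists_coord_eq hd hm (cone_mem_closure hd hm x t)

/-- Expresses that `hat Y` is open for the coordinate topology, whatever the set `Y`. -/
theorem exists_mem_hat_of_mem (hd : HasDenseNorms K) (hm : HasManyDirections K)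
    {S : Ber K} {Y : Set (P1 K)} (hY : Y ∈ S.1) :
    ∃ W, IsOpen W ∧ S.coord ∈ W ∧ ∀ T : Ber K, T.coord ∈ W → Y ∈ T.1 := by
  rw [S.filter_eq_comap hd hm] at hY
  obtain ⟨W', hW', hWY⟩ := hY
  obtain ⟨W, hW, hWo, hSW⟩ := mem_nhds_iff.1 hW'
  refine ⟨W, hWo, hSW, fun T hT => ?_⟩
  rw [T.filter_eq_comap hd hm]
  exact ⟨W, hWo.mem_nhds hT, (preimage_mono hW).trans hWY⟩

theorem isInducing_coord (hd : HasDenseNorms K) (hm : HasManyDirections K) :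
    IsInducing (coord : Ber K → K → ℝ≥0∞) := by
  refine ⟨le_antisymm (continuous_coord hd).le_induced fun O hO => ?_⟩
  have : ∀ S ∈ O, ∃ W, IsOpen W ∧ S.coord ∈ W ∧ coord ⁻¹' W ⊆ O := by
    intro S hS
    obtain ⟨V, ⟨C, hC, hCV⟩, hVO⟩ := hO S hS
    obtain ⟨Y, hY, hYS⟩ := exists_mem_cover_of_tendsto hm (S.tendsto_coord hd) hC
    obtain ⟨W, hWo, hSW, hW⟩ := exists_mem_hat_of_mem hd hm hYS
    exact ⟨W, hWo, hSW, fun T hT =>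
      hVO ⟨Y, hYS, hW T hT, (prod_subset_coverEntourage hY).trans hCV⟩⟩
  choose! W hWo hSW hWO using this
  refine isOpen_induced_iff.2 ⟨⋃ S ∈ O, W S, isOpen_biUnion hWo, ?_⟩
  ext T
  simp only [mem_preimage, mem_iUnion, exists_prop]
  exact ⟨fun ⟨S, hS, hT⟩ => hWO S hS hT, fun hT => ⟨T, hT, hSW T hT⟩⟩

/-- The delicate case is `S.coord a = r`. If some `c` is closer to `S` than `a` is, the points near
`S` are at distance at least `r` from `a`. Otherwise `S` is the cone of radius `r` at `a`, and the
ball would also belong to cones of slightly larger radius. -/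
theorem setOf_edistTo_lt_mem_iff (hd : HasDenseNorms K) (hm : HasManyDirections K)
    {S : Ber K} {a : K} {r : ℝ≥0∞} (hr : r ≠ ⊤) :
    {p | edistTo p a < r} ∈ S.1 ↔ S.coord a < r := by
  refine ⟨fun h => ?_, setOf_edistTo_lt_mem hd⟩
  by_contra! hle
  rcases hle.lt_or_eq with hlt | heq
  · exact false_of_edistTo_lt_mem_of_lt_edistTo_mem le_rfl h (setOf_lt_edistTo_mem hd hlt)
  by_cases hc : ∃ c, S.coord c < S.coord a
  · obtain ⟨c, hc⟩ := hc
    obtain ⟨p, hp, hp'⟩ := S.1.nonempty_of_mem (inter_mem h (setOf_edistTo_lt_mem hd hc))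
    have h1 := enorm_sub_eq_coord hd hc
    have h2 := enorm_sub_le_max_edistTo p c a
    rw [h1] at h2
    exact (max_lt hp' (hp.trans_le hle)).not_ge h2
  · push Not at hc
    obtain ⟨W, hWo, hSW, hW⟩ := exists_mem_hat_of_mem hd hm h
    rw [eq_cone_of_forall_le (S.coord_mem_closure hd) hc, ← heq] at hSW
    have := nhdsGT_neBot_of_exists_gt ⟨⊤, lt_top_iff_ne_top.2 hr⟩
    obtain ⟨t, ht, htW⟩ := ((frequently_gt_nhds r).and_eventually
      ((continuous_cone a).continuousAt.eventually (hWo.mem_nhds hSW))).exists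
    obtain ⟨T, hT⟩ := exists_coord_eq_cone hd hm a t
    exact false_of_edistTo_lt_mem_of_lt_edistTo_mem le_rfl (hW T (by rw [hT]; exact htW))
      (setOf_lt_edistTo_mem hd (by rwa [hT, cone_self]))

theorem setOf_lt_edistTo_mem_iff (hd : HasDenseNorms K) (hm : HasManyDirections K)
    {S : Ber K} {a : K} {r : ℝ≥0∞} (hr : r ≠ 0) :
    {p | r < edistTo p a} ∈ S.1 ↔ r < S.coord a := by
  refine ⟨fun h => ?_, setOf_lt_edistTo_mem hd⟩
  by_contra! hle
  rcases hle.lt_or_eq with hlt | heq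
  · exact false_of_edistTo_lt_mem_of_lt_edistTo_mem le_rfl (setOf_edistTo_lt_mem hd hlt) h
  by_cases hc : ∃ c, S.coord c < S.coord a
  · obtain ⟨c, hc⟩ := hc
    obtain ⟨p, hp, hp'⟩ := S.1.nonempty_of_mem (inter_mem h (setOf_edistTo_lt_mem hd hc))
    have h1 := enorm_sub_eq_coord hd hc
    have h2 := edistTo_le_max p a c
    rw [h1, heq] at h2
    exact (lt_of_lt_of_le hp h2).not_ge (max_le (heq ▸ hp'.le) le_rfl)
  · push Not at hc
    obtain ⟨W, hWo, hSW, hW⟩ := exists_mem_hat_of_mem hd hm h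
    rw [eq_cone_of_forall_le (S.coord_mem_closure hd) hc, heq] at hSW
    have := nhdsLT_neBot_of_exists_lt ⟨0, pos_iff_ne_zero.2 hr⟩
    obtain ⟨t, ht, htW⟩ := ((frequently_lt_nhds r).and_eventually
      ((continuous_cone a).continuousAt.eventually (hWo.mem_nhds hSW))).exists
    obtain ⟨T, hT⟩ := exists_coord_eq_cone hd hm a t
    exact false_of_edistTo_lt_mem_of_lt_edistTo_mem le_rfl
      (setOf_edistTo_lt_mem hd (by rwa [hT, cone_self])) (hW T (by rw [hT]; exact htW))

/-- Cones include the points of the projective line (radius 0, or `⊤` for `∞`), so they are dense in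
any open set; a set between a preconnected set and its closure is preconnected. -/
theorem isPreconnected_of_cones (hd : HasDenseNorms K) (hm : HasManyDirections K)
    {E : Set (Ber K)} (hE : IsOpen E)
    (h : IsPreconnected {T ∈ E | ∃ x t, T.coord = cone x t}) : IsPreconnected E := by
  refine h.subset_closure (sep_subset _ _) fun T hT => ?_
  rw [(isInducing_coord hd hm).closure_eq_preimage_closure_image, mem_preimage]
  refine mem_closure_iff.2 fun W hW hTW => ?_
  obtain ⟨W', hW', rfl⟩ := (isInducing_coord hd hm).isOpen_iff.1 hE
  obtain ⟨_, ⟨h1, h2⟩, p, rfl⟩ := mem_closure_iff.1 (T.coord_mem_closure hd) (W ∩ W')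
    (hW.inter hW') ⟨hTW, hT⟩
  obtain ⟨S, hS⟩ := exists_coord_eq hd hm (subset_closure (mem_range_self p))
  refine ⟨_, h1, S, ⟨by rw [mem_preimage, hS]; exact h2, ?_⟩, hS⟩
  by_cases hp : p ∈ range (ofField : K → P1 K)
  · obtain ⟨z, rfl⟩ := hp
    exact ⟨z, 0, by rw [hS, cone_zero]⟩
  · exact ⟨0, ⊤, by rw [hS, cone_top]; ext a; rw [edistTo_eq_top hp]⟩

theorem isPreconnected_cones (hd : HasDenseNorms K) (hm : HasManyDirections K)
    (x : K) {I : Set ℝ≥0∞} (hI : I.OrdConnected) :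
    IsPreconnected {T : Ber K | ∃ t ∈ I, T.coord = cone x t} := by
  choose g hg using exists_coord_eq_cone hd hm x
  have hgc : Continuous g := by
    rw [(isInducing_coord hd hm).continuous_iff]
    convert continuous_cone x using 1
    exact funext hg
  have : {T : Ber K | ∃ t ∈ I, T.coord = cone x t} = g '' I := by
    ext T
    constructor
    · rintro ⟨t, ht, h⟩
      exact ⟨t, ht, coord_injective hd hm ((hg t).trans h.symm)⟩
    · rintro ⟨t, ht, rfl⟩
      exact ⟨t, ht, hg t⟩
  rw [this]
  exact hI.isPreconnected.image _ hgc.continuousOn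

theorem isPreconnected_lt_coord (hd : HasDenseNorms K) (hm : HasManyDirections K)
    (a : K) (r : ℝ≥0∞) :
    IsPreconnected {T : Ber K | r < T.coord a} := by
  rcases eq_top_or_lt_top r with rfl | hr
  · simp [isPreconnected_empty]
  refine isPreconnected_of_cones hd hm (isOpen_lt_coord hd a r) ?_
  obtain ⟨P, hP⟩ := exists_coord_eq_cone hd hm a ⊤
  refine isPreconnected_of_forall P ?_
  rintro T ⟨hT, x, t, hxt⟩
  -- Enlarging the radius leads from `T` to `∞` without decreasing the distance to `a`.
  refine ⟨_, ?_, ?_, ?_, isPreconnected_cones hd hm x (I := {t | r < max t ‖x - a‖ₑ}) ?_⟩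
  · rintro S ⟨s, hs, hS⟩
    exact ⟨by rw [mem_ofPred_eq, hS]; exact hs, x, s, hS⟩
  · exact ⟨⊤, lt_max_of_lt_left hr, by rw [hP, cone_top, cone_top]⟩
  · exact ⟨t, by rw [mem_ofPred_eq, hxt] at hT; exact hT, hxt⟩
  · exact IsUpperSet.ordConnected fun s t hst hs => hs.trans_le (max_le_max hst le_rfl)

theorem isPreconnected_coord_lt (hd : HasDenseNorms K) (hm : HasManyDirections K)
    (a : K) (r : ℝ≥0∞) :
    IsPreconnected {T : Ber K | T.coord a < r} := by
  rcases eq_zero_or_pos r with rfl | hr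
  · simp [isPreconnected_empty]
  refine isPreconnected_of_cones hd hm (isOpen_coord_lt hd a r) ?_
  obtain ⟨P, hP⟩ := exists_coord_eq_cone hd hm a 0
  refine isPreconnected_of_forall P ?_
  rintro T ⟨hT, x, t, hxt⟩
  rw [mem_ofPred_eq, hxt] at hT
  have hxa : ‖x - a‖ₑ < r := (le_max_right _ _).trans_lt hT
  -- `Q`, the smallest closed ball around both centres, is where the paths from `x` and from `a`
  -- meet.
  obtain ⟨Q, hQ⟩ := exists_coord_eq_cone hd hm a ‖x - a‖ₑ
  have hQa : Q ∈ {T : Ber K | ∃ t ∈ Iio r, T.coord = cone a t} := ⟨_, hxa, hQ⟩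
  have hQx : Q ∈ {T : Ber K | ∃ t ∈ Iio r, T.coord = cone x t} :=
    ⟨_, hxa, by rw [hQ, cone_eq_cone (le_refl ‖x - a‖ₑ)]⟩
  have hU := (isPreconnected_cones hd hm a (I := Iio r) ordConnected_Iio).union Q hQa hQx
    (isPreconnected_cones hd hm x (I := Iio r) ordConnected_Iio)
  refine ⟨_, ?_, .inl ⟨0, hr, hP⟩, .inr ⟨t, (le_max_left _ _).trans_lt hT, hxt⟩, hU⟩
  rintro S (⟨s, hs, hS⟩ | ⟨s, hs, hS⟩)
  · exact ⟨by rw [mem_ofPred_eq, hS, cone_self]; exact hs, a, s, hS⟩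
  · exact ⟨by rw [mem_ofPred_eq, hS]; exact max_lt hs hxa, x, s, hS⟩

end Coordinates

/-! ### Types of points: cores, directions, and complements of classical and singular points. -/

section Points

variable {K : Type*} [NormedField K]

theorem IsClassical.exists_coord_eq_edistTo (hd : HasDenseNorms K) {S : Ber K}
    (h : S.IsClassical) : ∃ p, S.coord = edistTo p := by
  obtain ⟨p, hp⟩ := h
  refine ⟨p, coord_eq_of_tendsto hd (tendsto_pi_nhds.2 fun a => tendsto_order.2
    ⟨fun r hr => ?_, fun r hr => ?_⟩)⟩
  · obtain ⟨v, hv, h1, h2⟩ := hd hr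
    obtain ⟨w, hw, h3, h4⟩ := hd h2
    refine mem_of_superset (hp _ (coverEntourage_pair_mem a hv hw h3)) fun y hy => ?_
    obtain ⟨Y, hY, hpY, hyY⟩ := mem_iUnion₂.1 hy
    rcases hY with rfl | rfl
    · exact (h4.not_gt hpY).elim
    · exact h1.trans hyY
  · obtain ⟨w, hw, h1, h2⟩ := hd hr
    obtain ⟨v, hv, h3, h4⟩ := hd h1
    refine mem_of_superset (hp _ (coverEntourage_pair_mem a hv hw h4)) fun y hy => ?_
    obtain ⟨Y, hY, hpY, hyY⟩ := mem_iUnion₂.1 hy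
    rcases hY with rfl | rfl
    · exact lt_trans hyY h2
    · exact (h3.not_gt hpY).elim

theorem setOf_norm_sub_lt_subset (a : K) (r : ℝ) :
    {z : K | ‖z - a‖ < r} ⊆ {z | ‖z - a‖ ≤ r} := by
  intro z hz
  rw [mem_ofPred_eq] at hz ⊢
  exact hz.le

theorem setOf_norm_sub_lt_eq_of_notMem_valueGroup {r : ℝ} (hr : 0 < r) (hr' : r ∉ valueGroup K)
    (a : K) : {z : K | ‖z - a‖ < r} = {z | ‖z - a‖ ≤ r} := by
  refine (setOf_norm_sub_lt_subset a r).antisymm fun z h => ?_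
  refine lt_of_le_of_ne h fun he => hr' ⟨z - a, ?_, he⟩
  rintro h0
  rw [h0, norm_zero] at he
  exact hr.ne he

theorem _root_.BerkovichLine.IsBallK.exists_eq {D : Set K} (hD : IsBallK D) :
    ∃ c : K, ∃ s : ℝ, 0 < s ∧ (D = {z | ‖z - c‖ < s} ∨ D = {z | ‖z - c‖ ≤ s}) := by
  rcases hD with ⟨c, _, ⟨w, hw, rfl⟩, rfl⟩ | ⟨c, _, ⟨w, hw, rfl⟩, rfl⟩ | ⟨c, s, hs, -, rfl⟩
  · exact ⟨c, _, norm_pos_iff.2 hw, .inl rfl⟩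
  · exact ⟨c, _, norm_pos_iff.2 hw, .inr rfl⟩
  · exact ⟨c, s, hs, .inl rfl⟩

theorem exists_eq_of_isOpenBall_or_isIrrationalBall {B : Set (P1 K)}
    (hB : IsOpenBall B ∨ IsIrrationalBall B) : ∃ c : K, ∃ s : ℝ, 0 < s ∧
      (B = ofField '' {z | ‖z - c‖ < s} ∨ B = (ofField '' {z | ‖z - c‖ ≤ s})ᶜ) := by
  rcases hB with (⟨_, ⟨c, _, ⟨w, hw, rfl⟩, rfl⟩, rfl⟩ | ⟨_, ⟨c, _, ⟨w, hw, rfl⟩, rfl⟩, rfl⟩) |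
    ⟨_, ⟨c, s, hs, hs', rfl⟩, rfl | rfl⟩
  · exact ⟨c, _, norm_pos_iff.2 hw, .inl rfl⟩
  · exact ⟨c, _, norm_pos_iff.2 hw, .inr rfl⟩
  · exact ⟨c, s, hs, .inl rfl⟩
  · exact ⟨c, s, hs, .inr (by rw [setOf_norm_sub_lt_eq_of_notMem_valueGroup hs hs'])⟩

theorem isOpenBall_or_isIrrationalBall_image_ball (c : K) {r : ℝ} (hr : 0 < r) :
    IsOpenBall (ofField '' {z : K | ‖z - c‖ < r}) ∨
      IsIrrationalBall (ofField '' {z : K | ‖z - c‖ < r}) := by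
  by_cases h : r ∈ valueGroup K
  · exact .inl (.inl ⟨_, ⟨c, r, h, rfl⟩, rfl⟩)
  · exact .inr ⟨_, ⟨c, r, hr, h, rfl⟩, .inl rfl⟩

theorem isOpenBall_or_isIrrationalBall_compl_image_closedBall (c : K) {r : ℝ} (hr : 0 < r) :
    IsOpenBall (ofField '' {z : K | ‖z - c‖ ≤ r})ᶜ ∨
      IsIrrationalBall (ofField '' {z : K | ‖z - c‖ ≤ r})ᶜ := by
  by_cases h : r ∈ valueGroup K
  · exact .inl (.inr ⟨_, ⟨c, r, h, rfl⟩, rfl⟩)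
  · rw [← setOf_norm_sub_lt_eq_of_notMem_valueGroup hr h]
    exact .inr ⟨_, ⟨c, r, hr, h, rfl⟩, .inr rfl⟩

theorem image_ofField_ne_compl_image_ofField (D E : Set K) :
    ofField '' D ≠ (ofField '' E)ᶜ := by
  intro h
  obtain ⟨p, hp⟩ := exists_notMem_range_ofField (K := K)
  have h1 : p ∈ (ofField '' E)ᶜ := fun ⟨z, _, hz⟩ => hp ⟨z, hz⟩
  rw [← h] at h1
  exact hp (image_subset_range _ _ h1)

theorem exists_core_eq {S : Ber K} (h : S.IsRational ∨ S.IsIrrational) :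
    ∃ a : K, ∃ r : ℝ, 0 < r ∧ S.core = {z | ‖z - a‖ ≤ r} := by
  rcases h with ⟨-, a, _, ⟨w, hw, rfl⟩, h⟩ | ⟨-, a, r, hr, hr', h⟩
  · exact ⟨a, _, norm_pos_iff.2 hw, h⟩
  · exact ⟨a, r, hr, by rw [h, setOf_norm_sub_lt_eq_of_notMem_valueGroup hr hr']⟩

variable [IsUltrametricDist K]

theorem diam_eq_of_ball_subset (hd : HasDenseNorms K) {D : Set K} {c : K} {r : ℝ} (hr : 0 < r)
    (h1 : {z | ‖z - c‖ < r} ⊆ D) (h2 : D ⊆ {z | ‖z - c‖ ≤ r}) : Metric.diam D = r := by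
  have hle : ∀ x ∈ D, ∀ y ∈ D, dist x y ≤ r := by
    intro x hx y hy
    rw [dist_eq_norm]
    refine (norm_sub_le_max x c y).trans (max_le (h2 hx) ?_)
    rw [norm_sub_rev]
    exact h2 hy
  refine le_antisymm (Metric.diam_le_of_forall_dist_le hr.le hle) (le_of_forall_lt fun s hs => ?_)
  obtain ⟨w, -, hw1, hw2⟩ := hd ((ENNReal.ofReal_lt_ofReal_iff hr).2 hs)
  have hsw : s < ‖w‖ := by
    by_contra! hle
    rw [← ofReal_norm] at hw1
    exact hw1.not_ge (ENNReal.ofReal_le_ofReal hle)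
  have hwr : ‖w‖ < r := norm_lt_iff_enorm_lt_ofReal.2 hw2
  have hm1 : c + w ∈ D := h1 (by simpa using hwr)
  have hm2 : c ∈ D := h1 (by simpa using hr)
  refine hsw.trans_le ?_
  have := Metric.dist_le_diam_of_mem (Metric.isBounded_iff.2 ⟨r, fun x hx y hy => hle x hx y hy⟩)
    hm1 hm2
  simpa [dist_eq_norm] using this

theorem image_ball_mem_iff (hd : HasDenseNorms K) (hm : HasManyDirections K)
    {S : Ber K} {a : K} {r : ℝ} :
    ofField '' {z : K | ‖z - a‖ < r} ∈ S.1 ↔ S.coord a < ENNReal.ofReal r := by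
  rw [image_ball, setOf_edistTo_lt_mem_iff hd hm ENNReal.ofReal_ne_top]

theorem compl_image_closedBall_mem_iff (hd : HasDenseNorms K) (hm : HasManyDirections K)
    {S : Ber K} {a : K} {r : ℝ} (hr : 0 < r) :
    (ofField '' {z : K | ‖z - a‖ ≤ r})ᶜ ∈ S.1 ↔ ENNReal.ofReal r < S.coord a := by
  rw [compl_image_closedBall a hr.le,
    setOf_lt_edistTo_mem_iff hd hm (ENNReal.ofReal_pos.2 hr).ne']

theorem coord_le_of_image_closedBall_mem (hd : HasDenseNorms K) (hm : HasManyDirections K)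
    {S : Ber K} {a : K} {r : ℝ} (hr : 0 < r)
    (h : ofField '' {z : K | ‖z - a‖ ≤ r} ∈ S.1) : S.coord a ≤ ENNReal.ofReal r := by
  by_contra! hlt
  have := inter_mem h ((compl_image_closedBall_mem_iff hd hm hr).2 hlt)
  rw [inter_compl_self] at this
  exact S.1.empty_notMem this

/-- The core fixes the coordinates. Every ball in `S` that contains `a` has radius at least `S.coord
a`, so a coordinate above `r` would put points farther than `r` from `a` in the core. A coordinate
below `r` would give a ball in `S` too small to contain the core. -/
theorem coord_eq_cone_of_core_eq (hd : HasDenseNorms K) (hm : HasManyDirections K)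
    {S : Ber K} {a : K} {r : ℝ} (hr : 0 < r)
    (h : S.core = {z | ‖z - a‖ ≤ r}) : S.coord = cone a (ENNReal.ofReal r) := by
  have ha : a ∈ S.core := by rw [h]; simpa using hr.le
  have hle : S.coord a ≤ ENNReal.ofReal r := by
    by_contra! hlt
    obtain ⟨w, -, hw1, hw2⟩ := hd hlt
    have hw : a + w ∈ S.core := by
      rintro D ⟨hD, hDS⟩
      have haD : a ∈ D := ha D ⟨hD, hDS⟩
      obtain ⟨c, s, hs, rfl | rfl⟩ := hD.exists_eq
      · have h1 := (image_ball_mem_iff hd hm).1 hDS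
        have h2 : ‖a - c‖ₑ < ENNReal.ofReal s := norm_lt_iff_enorm_lt_ofReal.1 haD
        have h3 := S.coord_le_max hd a c
        rw [enorm_sub_rev] at h3
        have h4 := enorm_sub_le_max (a + w) a c
        rw [add_sub_cancel_left] at h4
        exact norm_lt_iff_enorm_lt_ofReal.2
          (h4.trans_lt (max_lt (hw2.trans (h3.trans_lt (max_lt h1 h2))) h2))
      · have h1 := coord_le_of_image_closedBall_mem hd hm hs hDS
        have h2 : ‖a - c‖ₑ ≤ ENNReal.ofReal s := (norm_le_iff_enorm_le_ofReal hs.le).1 haD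
        have h3 := S.coord_le_max hd a c
        rw [enorm_sub_rev] at h3
        have h4 := enorm_sub_le_max (a + w) a c
        rw [add_sub_cancel_left] at h4
        exact (norm_le_iff_enorm_le_ofReal hs.le).2
          (h4.trans (max_le (hw2.le.trans (h3.trans (max_le h1 h2))) h2))
    rw [h, mem_ofPred_eq, add_sub_cancel_left, norm_le_iff_enorm_le_ofReal hr.le] at hw
    exact hw1.not_ge hw
  have hge : ∀ c, ENNReal.ofReal r ≤ S.coord c := by
    intro c
    by_contra! hlt
    obtain ⟨w, hw, hw1, hw2⟩ := hd hlt
    obtain ⟨v, -, hv1, hv2⟩ := hd hw2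
    have hB : S.core ⊆ {z | ‖z - c‖ < ‖w‖} := sInter_subset_of_mem
      ⟨.inl ⟨c, _, ⟨w, hw, rfl⟩, rfl⟩, (image_ball_mem_iff hd hm).2 (by rwa [ofReal_norm])⟩
    have h1 : ‖a - c‖ < ‖w‖ := hB ha
    have h2 : ‖a + v - c‖ < ‖w‖ := hB (by
      rw [h, mem_ofPred_eq, add_sub_cancel_left, norm_le_iff_enorm_le_ofReal hr.le]
      exact hv2.le)
    have h3 := norm_sub_le_max (a + v) c a
    rw [add_sub_cancel_left, norm_sub_rev c a] at h3
    exact hv1.not_ge (enorm_le_enorm_iff_norm_le.2 (h3.trans (max_lt h2 h1).le))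
  have he : S.coord a = ENNReal.ofReal r := le_antisymm hle (hge a)
  rw [← he]
  exact eq_cone_of_forall_le (S.coord_mem_closure hd) fun c => he ▸ hge c

/-- Since norms are dense, the diameter of a ball is its radius, so equality of diameters forces the
radius `r`. This treats rational and irrational points alike. -/
theorem mem_directions_iff (hd : HasDenseNorms K) {S : Ber K}
    (hS : S.IsRational ∨ S.IsIrrational) {a : K} {r : ℝ} (hr : 0 < r)
    (h : S.core = {z | ‖z - a‖ ≤ r}) {B : Set (P1 K)} : B ∈ S.directions ↔
      (∃ c : K, ‖c - a‖ ≤ r ∧ B = ofField '' {z | ‖z - c‖ < r}) ∨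
        B = (ofField '' {z | ‖z - a‖ ≤ r})ᶜ := by
  have hcore : Metric.diam S.core = r :=
    diam_eq_of_ball_subset hd hr (by rw [h]; exact setOf_norm_sub_lt_subset a r)
      h.subset
  constructor
  · rintro ⟨hB, D, hD, -, hsub, hdiam⟩
    obtain ⟨c, s, hs, rfl | rfl⟩ := exists_eq_of_isOpenBall_or_isIrrationalBall hB
    · rcases hD with hD | hD
      · rw [ofField_injective.image_injective.eq_iff] at hD
        subst hD
        rw [hcore, diam_eq_of_ball_subset hd hs Subset.rfl (setOf_norm_sub_lt_subset c _)] at hdiam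
        subst hdiam
        have hc : c ∈ S.core := hsub (by simpa using hs)
        rw [h] at hc
        exact .inl ⟨c, hc, rfl⟩
      · exact (image_ofField_ne_compl_image_ofField _ _ hD).elim
    · rcases hD with hD | hD
      · exact (image_ofField_ne_compl_image_ofField _ _ hD.symm).elim
      · rw [compl_inj_iff, ofField_injective.image_injective.eq_iff] at hD
        subst hD
        rw [hcore, diam_eq_of_ball_subset hd hs (setOf_norm_sub_lt_subset c s) Subset.rfl] at hdiam
        subst hdiam
        have hc : c ∈ S.core := hsub (by simpa using hs.le)
        rw [h] at hc hsub
        refine .inr (congrArg (fun E => (ofField '' E)ᶜ) (hsub.antisymm fun z hz => ?_))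
        refine (norm_sub_le_max z a c).trans (max_le hz ?_)
        rw [norm_sub_rev]
        exact hc
  · rintro (⟨c, hc, rfl⟩ | rfl)
    · refine ⟨isOpenBall_or_isIrrationalBall_image_ball c hr, _, .inl rfl, hS, ?_, ?_⟩
      · rw [h]
        exact fun z hz => (norm_sub_le_max z c a).trans (max_le (le_of_lt hz) hc)
      · rw [hcore, diam_eq_of_ball_subset hd hr Subset.rfl (setOf_norm_sub_lt_subset c _)]
    · refine ⟨isOpenBall_or_isIrrationalBall_compl_image_closedBall a hr, _, .inr rfl, hS, ?_, ?_⟩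
      · rw [h]
      · rw [h]

theorem hat_image_ball (hd : HasDenseNorms K) (hm : HasManyDirections K)
    (c : K) (r : ℝ) :
    hat (ofField '' {z : K | ‖z - c‖ < r}) = {T | T.coord c < ENNReal.ofReal r} :=
  ext fun _ => image_ball_mem_iff hd hm

theorem hat_compl_image_closedBall (hd : HasDenseNorms K) (hm : HasManyDirections K)
    (c : K) {r : ℝ} (hr : 0 < r) :
    hat (ofField '' {z : K | ‖z - c‖ ≤ r})ᶜ = {T | ENNReal.ofReal r < T.coord c} :=
  ext fun _ => compl_image_closedBall_mem_iff hd hm hr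

theorem IsClassical.isConnected_compl (hd : HasDenseNorms K) (hm : HasManyDirections K)
    {S : Ber K} (h : S.IsClassical) :
    IsConnected ({S}ᶜ : Set (Ber K)) := by
  obtain ⟨p, hp⟩ := h.exists_coord_eq_edistTo hd
  by_cases hpK : p ∈ range (ofField : K → P1 K)
  · obtain ⟨x, rfl⟩ := hpK
    have : ({S}ᶜ : Set (Ber K)) = {T | 0 < T.coord x} := by
      ext T
      rw [mem_compl_iff, mem_singleton_iff, mem_ofPred_eq, pos_iff_ne_zero, not_iff_not,
        ← (coord_injective hd hm).eq_iff, hp]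
      refine ⟨fun hT => by simp [hT], fun hT => ?_⟩
      rw [← cone_zero, ← hT]
      exact eq_cone_of_forall_le (T.coord_mem_closure hd) fun c => by simp [hT]
    rw [this]
    obtain ⟨P, hP⟩ := exists_coord_eq_cone hd hm x ⊤
    exact ⟨⟨P, by simp [hP]⟩, isPreconnected_lt_coord hd hm x 0⟩
  · have : ({S}ᶜ : Set (Ber K)) = {T | T.coord 0 < ⊤} := by
      ext T
      rw [mem_compl_iff, mem_singleton_iff, mem_ofPred_eq, lt_top_iff_ne_top, not_iff_not,
        ← (coord_injective hd hm).eq_iff, hp]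
      refine ⟨fun hT => by rw [hT, edistTo_eq_top hpK], fun hT => ?_⟩
      ext a
      rw [edistTo_eq_top hpK]
      have := T.coord_le_max hd 0 a
      rw [hT, top_le_iff] at this
      simpa [max_eq_top] using this
    rw [this]
    obtain ⟨P, hP⟩ := exists_coord_eq_cone hd hm (0 : K) 0
    exact ⟨⟨P, by simp [hP]⟩, isPreconnected_coord_lt hd hm 0 ⊤⟩

theorem IsSingular.isConnected_compl (hd : HasDenseNorms K) (hm : HasManyDirections K)
    {S : Ber K} (h : S.IsSingular) :
    IsConnected ({S}ᶜ : Set (Ber K)) := by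
  -- As the core is empty, some ball in `S` misses `a`; its centre `c` then satisfies `S.coord a =
  -- ‖c - a‖ₑ`.
  have hS : ∀ a, ∃ c, S.coord c < ‖c - a‖ₑ := by
    intro a
    have ha : a ∉ S.core := by simp [h.2]
    simp only [core, mem_sInter, not_forall] at ha
    obtain ⟨D, ⟨hD, hDS⟩, haD⟩ := ha
    obtain ⟨c, s, hs, rfl | rfl⟩ := hD.exists_eq
    · refine ⟨c, ((image_ball_mem_iff hd hm).1 hDS).trans_le (not_lt.1 fun hlt => haD ?_)⟩
      rw [enorm_sub_rev] at hlt
      exact norm_lt_iff_enorm_lt_ofReal.2 hlt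
    · refine ⟨c, (coord_le_of_image_closedBall_mem hd hm hs hDS).trans_lt
        (not_le.1 fun hle => haD ?_)⟩
      rw [enorm_sub_rev] at hle
      exact (norm_le_iff_enorm_le_ofReal hs.le).2 hle
  have hcompl : ({S}ᶜ : Set (Ber K)) =
      ⋃₀ {A | ∃ c R, S.coord c < R ∧ R < ⊤ ∧ A = {T : Ber K | R < T.coord c}} := by
    ext T
    rw [mem_compl_iff, mem_singleton_iff]
    constructor
    · intro hTS
      -- If no coordinate of `T` exceeded that of `S`, the same centres would compute the
      -- coordinates of `T`, and `T` would equal `S`.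
      have : ∃ c, S.coord c < T.coord c := by
        by_contra! hle
        refine hTS (coord_injective hd hm (funext fun a => ?_))
        obtain ⟨c, hc⟩ := hS a
        rw [coord_eq_enorm_sub hd hc, coord_eq_enorm_sub hd ((hle c).trans_lt hc)]
      obtain ⟨c, hc⟩ := this
      obtain ⟨R, hR1, hR2⟩ := exists_between hc
      exact ⟨_, ⟨c, R, hR1, hR2.trans_le le_top, rfl⟩, hR2⟩
    · rintro ⟨_, ⟨c, R, hR, -, rfl⟩, hT⟩ rfl
      exact lt_asymm hR hT
  obtain ⟨P, hP⟩ := exists_coord_eq_cone hd hm (0 : K) ⊤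
  rw [cone_top] at hP
  constructor
  · refine ⟨P, fun hPS => ?_⟩
    obtain ⟨c, hc⟩ := hS 0
    rw [mem_singleton_iff] at hPS
    rw [← hPS, hP] at hc
    exact not_top_lt hc
  · rw [hcompl]
    refine isPreconnected_sUnion P _ ?_ ?_
    · rintro _ ⟨c, R, -, hR, rfl⟩
      rwa [mem_ofPred_eq, hP]
    · rintro _ ⟨c, R, -, -, rfl⟩
      exact isPreconnected_lt_coord hd hm c R

end Points

/-- Each part of a partition into open sets is separated from the union of the others, so a
component cannot leave the part in which it starts. -/
theorem _root_.BerkovichLine.setOf_connectedComponentIn_eq {X : Type*} [TopologicalSpace X]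
    {E : Set X} {𝓕 : Set (Set X)} (hne : ∀ A ∈ 𝓕, A.Nonempty) (ho : ∀ A ∈ 𝓕, IsOpen A)
    (hc : ∀ A ∈ 𝓕, IsPreconnected A) (hdisj : 𝓕.PairwiseDisjoint id) (hcov : ⋃₀ 𝓕 = E) :
    {A | ∃ T ∈ E, A = connectedComponentIn E T} = 𝓕 := by
  have key : ∀ A ∈ 𝓕, ∀ T ∈ A, connectedComponentIn E T = A := by
    intro A hA T hT
    have hAE : A ⊆ E := hcov ▸ subset_sUnion_of_mem hA
    refine Subset.antisymm ?_ ((hc A hA).subset_connectedComponentIn hT hAE)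
    refine IsPreconnected.subset_left_of_subset_union (v := ⋃₀ (𝓕 \ {A})) (ho A hA)
      (isOpen_sUnion fun A' hA' => ho A' hA'.1) ?_ ?_
      ⟨T, mem_connectedComponentIn (hAE hT), hT⟩ isPreconnected_connectedComponentIn
    · exact disjoint_sUnion_right.2 fun A' hA' => hdisj hA hA'.1 (Ne.symm hA'.2)
    · refine (connectedComponentIn_subset E T).trans ?_
      rw [← hcov]
      rintro x ⟨A', hA', hx⟩
      by_cases h : A' = A
      · exact .inl (h ▸ hx)
      · exact .inr ⟨A', ⟨hA', h⟩, hx⟩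
  ext A
  constructor
  · rintro ⟨T, hT, rfl⟩
    rw [← hcov] at hT
    obtain ⟨A, hA, hTA⟩ := hT
    rwa [key A hA T hTA]
  · intro hA
    obtain ⟨T, hT⟩ := hne A hA
    exact ⟨T, hcov ▸ ⟨A, hA, hT⟩, (key A hA T hT).symm⟩

/-! ### Components of the complement of a rational or irrational point. -/

section Components

variable {K : Type*} [NormedField K] [IsUltrametricDist K]

theorem setOf_connectedComponentIn_compl_eq (hd : HasDenseNorms K) (hm : HasManyDirections K)
    {S : Ber K} (hS : S.IsRational ∨ S.IsIrrational) :
    {A : Set (Ber K) | ∃ T ∈ ({S}ᶜ : Set (Ber K)), A = connectedComponentIn {S}ᶜ T} =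
      {A | ∃ B ∈ S.directions, A = hat B} := by
  obtain ⟨a, r, hr, hcore⟩ := exists_core_eq hS
  have hcoord := coord_eq_cone_of_core_eq hd hm hr hcore
  set R := ENNReal.ofReal r with hR
  have hR0 : 0 < R := ENNReal.ofReal_pos.2 hr
  have hRtop : R < ⊤ := ENNReal.ofReal_lt_top
  have hF : ∀ A, A ∈ {A | ∃ B ∈ S.directions, A = hat B} ↔
      (∃ c : K, ‖c - a‖ₑ ≤ R ∧ A = {T | T.coord c < R}) ∨ A = {T | R < T.coord a} := by
    intro A
    simp only [mem_ofPred_eq, mem_directions_iff hd hS hr hcore]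
    constructor
    · rintro ⟨_, ⟨c, hc, rfl⟩ | rfl, rfl⟩
      · exact .inl ⟨c, (norm_le_iff_enorm_le_ofReal hr.le).1 hc, hat_image_ball hd hm c r⟩
      · exact .inr (hat_compl_image_closedBall hd hm a hr)
    · rintro (⟨c, hc, rfl⟩ | rfl)
      · exact ⟨_, .inl ⟨c, (norm_le_iff_enorm_le_ofReal hr.le).2 hc, rfl⟩,
          (hat_image_ball hd hm c r).symm⟩
      · exact ⟨_, .inr rfl, (hat_compl_image_closedBall hd hm a hr).symm⟩
  apply setOf_connectedComponentIn_eq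
  · intro A hA
    rcases (hF A).1 hA with ⟨c, -, rfl⟩ | rfl
    · obtain ⟨P, hP⟩ := exists_coord_eq_cone hd hm c 0
      exact ⟨P, by simpa [hP] using hR0⟩
    · obtain ⟨P, hP⟩ := exists_coord_eq_cone hd hm a ⊤
      exact ⟨P, by simpa [hP] using hRtop⟩
  · intro A hA
    rcases (hF A).1 hA with ⟨c, -, rfl⟩ | rfl
    exacts [isOpen_coord_lt hd c R, isOpen_lt_coord hd a R]
  · intro A hA
    rcases (hF A).1 hA with ⟨c, -, rfl⟩ | rfl
    exacts [isPreconnected_coord_lt hd hm c R, isPreconnected_lt_coord hd hm a R]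
  · have hdis : ∀ c : K, ‖c - a‖ₑ ≤ R → ∀ T : Ber K, T.coord c < R → ¬ R < T.coord a :=
      fun c hc T hT => not_lt.2 ((T.coord_le_max hd a c).trans (max_le hT.le hc))
    intro A hA A' hA' hne
    refine disjoint_left.2 fun T hT hT' => ?_
    rcases (hF A).1 hA with ⟨c, hc, rfl⟩ | rfl <;> rcases (hF A').1 hA' with ⟨c', hc', rfl⟩ | rfl
    · have hcc : ‖c - c'‖ₑ < R := (T.enorm_sub_le_max_coord hd c c').trans_lt (max_lt hT hT')
      refine hne (ext fun U => ⟨fun hU => ?_, fun hU => ?_⟩)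
      · exact (U.coord_le_max hd c' c).trans_lt (max_lt hU hcc)
      · exact (U.coord_le_max hd c c').trans_lt (max_lt hU (by rwa [enorm_sub_rev]))
    · exact hdis c hc T hT hT'
    · exact hdis c' hc' T hT' hT
    · exact hne rfl
  · ext T
    rw [mem_compl_iff, mem_singleton_iff, mem_sUnion]
    constructor
    · rintro ⟨A, hA, hT⟩ rfl
      rcases (hF A).1 hA with ⟨c, -, rfl⟩ | rfl
      · rw [mem_ofPred_eq, hcoord] at hT
        exact (le_max_left _ _).not_gt hT
      · rw [mem_ofPred_eq, hcoord, cone_self] at hT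
        exact lt_irrefl _ hT
    · intro hTS
      -- A point in none of the parts has coordinate `R` at `a` and nowhere a smaller one, so it is
      -- the cone of radius `R` at `a`, which is `S`.
      by_contra! hno
      have h1 : T.coord a ≤ R := not_lt.1 (hno _ ((hF _).2 (.inr rfl)))
      have h2 : ∀ c, ‖c - a‖ₑ ≤ R → R ≤ T.coord c := fun c hc =>
        not_lt.1 (hno _ ((hF _).2 (.inl ⟨c, hc, rfl⟩)))
      have h3 : T.coord a = R := le_antisymm h1 (h2 a (by simp))
      refine hTS (coord_injective hd hm ?_)
      rw [hcoord, ← h3]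
      refine eq_cone_of_forall_le (T.coord_mem_closure hd) fun c => ?_
      rw [h3]
      rcases le_or_gt ‖c - a‖ₑ R with hc | hc
      · exact h2 c hc
      · rw [enorm_sub_rev, ← h3] at hc
        rw [coord_eq_enorm_sub hd hc, ← h3]
        exact hc.le

end Components

end Ber

end BerkovichLine

theorem mainTheorem9 {K : Type*} [NormedField K] [IsUltrametricDist K] [CompleteSpace K]
    (hres : Infinite (IsLocalRing.ResidueField (NormedField.valuation (K := K)).valuationSubring))
    (hval : ¬ DiscreteTopology (BerkovichLine.valueGroup K))
    (S : BerkovichLine.Ber K) :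
    ((S.IsRational ∨ S.IsIrrational) →
      {A : Set (BerkovichLine.Ber K) | ∃ T ∈ ({S}ᶜ : Set (BerkovichLine.Ber K)),
          A = connectedComponentIn {S}ᶜ T} =
        {A | ∃ B ∈ S.directions, A = BerkovichLine.Ber.hat B}) ∧
    ((S.IsSingular ∨ S.IsClassical) → IsConnected ({S}ᶜ : Set (BerkovichLine.Ber K))) := by
  have hd := BerkovichLine.hasDenseNorms_of_not_discrete hval
  have hm := BerkovichLine.hasManyDirections_of_infinite_residueField hres
  exact ⟨fun h => BerkovichLine.Ber.setOf_connectedComponentIn_compl_eq hd hm h,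
    fun h => h.elim (fun h => h.isConnected_compl hd hm) fun h => h.isConnected_compl hd hm⟩
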